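/- Let $V=\bigoplus_{n\ge 0}V_n$ be a vertex operator algebra over $\mathbb{C}$ of CFT type ($V_0=\mathbb{C}\mathbf 1$), put $V_+=\bigoplus_{n\ge1}V_n$, and let $M=\bigoplus_{n\ge 0}M(n)$ be an admissible $V$-module. Write $Y_M(a,z)=\sum_n a_n z^{-n-1}$. Let $C_2(M)=\mathrm{span}\{a_{-2}v : a\in V, v\in M\}$, let $O(M)$ be the span of the elements $\mathrm{Res}_z\, Y_M(a,z)v\,(1+z)^{\mathrm{wt}\,a}/z^2$ ($a\in V$ homogeneous, $v\in M$), and let $A(V)=V/O(V)$ be Zhu's algebra and $A(M)=M/O(M)$ the $A(V)$-module with $a\ast v=\mathrm{Res}_z\,Y_M(a,z)v\,(1+z)^{\mathrm{wt}\,a}/z$. Filter them by letting $A(V)_n$ and $A(M)_n$ be the images of $\bigoplus_{i\le n}V_i$ and $\bigoplus_{i\le n}M(i)$, with $A(V)_{-1}=A(M)_{-1}=0$; then $\mathrm{gr}\,A(M)=\bigoplus_{n\ge 0}A(M)_n/A(M)_{n-1}$ is a module over the ring $\mathrm{gr}\,A(V)=\bigoplus_{n\ge 0}A(V)_n/A(V)_{n-1}$.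 Let $\psi:M/C_2(M)\to \mathrm{gr}\,A(M)$ be the well-defined linear map with $\psi(v+C_2(M))=\bar v\in A(M)_n/A(M)_{n-1}$ for $v\in M(n)$. A subset $W\subseteq M$ is said to strongly generate $M$ if $M$ is spanned by the elements $a^1_{-n_1}\cdots a^k_{-n_k}w$ with $k\ge 0$, $a^i\in V_+$ homogeneous, $n_i\ge 1$ and $w\in W$; $M$ is strongly finitely generated if it is strongly generated by a finite subset. (1) If $M$ is strongly generated by a subset $W\subseteq M$, then $\mathrm{gr}\,A(M)$ is generated as a $\mathrm{gr}\,A(V)$-module by $\psi(W/C_2(M))=\{\psi(w+C_2(M)) : w\in W\}$. (2) If $M$ is strongly finitely generated, then $\mathrm{gr}\,A(M)$ is a finitely generated $\mathrm{gr}\,A(V)$-module. -/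

import Mathlib

open scoped DirectSum

noncomputable section

/-! ### Associated graded ring and module of a filtration indexed by `ℕ` -/

namespace Filt

variable {k R M : Type*} [CommRing k] [Ring R] [Module k R]
  [AddCommGroup M] [Module k M] [Module R M]

/-- The shifted family `n ↦ F (n - 1)`, with the convention `F (-1) = 0`. -/
def prev (F : ℕ → Submodule k M) : ℕ → Submodule k M
  | 0 => ⊥
  | n + 1 => F n

theorem isFiltration {F : ℕ → Submodule k M} (hF : Monotone F) :
    IsFiltration F (prev F) where
  mono := hF
  is_le {i j} h := by
    cases j with
    | zero => omega
    | succ j => exact hF (by omega)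
  is_sup B j h := by
    cases j with
    | zero => exact bot_le
    | succ j => exact h j (by omega)

/-- The graded piece `F n / F (n - 1)`. -/
def Piece (F : ℕ → Submodule k M) (n : ℕ) : Type _ :=
  F n ⧸ (prev F n).submoduleOf (F n)

instance (F : ℕ → Submodule k M) (n : ℕ) : AddCommGroup (Piece F n) :=
  inferInstanceAs (AddCommGroup (F n ⧸ (prev F n).submoduleOf (F n)))

instance (F : ℕ → Submodule k M) (n : ℕ) : Module k (Piece F n) :=
  inferInstanceAs (Module k (F n ⧸ (prev F n).submoduleOf (F n)))

/-- The class in `F n / F (n - 1)` of an element of `F n`. -/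
def toPiece (F : ℕ → Submodule k M) (n : ℕ) : F n →ₗ[k] Piece F n :=
  ((prev F n).submoduleOf (F n)).mkQ

/-- The associated graded space `⨁ n, F n / F (n - 1)`. -/
abbrev Gr (F : ℕ → Submodule k M) : Type _ := ⨁ n, Piece F n

theorem mk_eq_mk (F : ℕ → Submodule k M) {i j : ℕ} (h : i = j) (x : F i) (y : F j)
    (hxy : (x : M) = y) :
    GradedMonoid.mk (A := Piece F) i (toPiece F i x)
      = GradedMonoid.mk (A := Piece F) j (toPiece F j y) := by
  subst h
  rw [Subtype.ext hxy]

theorem toPiece_eq (F : ℕ → Submodule k M) {i : ℕ} {x y : F i}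
    (h : (x : M) - y ∈ prev F i) : toPiece F i x = toPiece F i y :=
  (Submodule.Quotient.eq _).2 h

theorem smul_prev_left {F : ℕ → Submodule k R} {G : ℕ → Submodule k M}
    [SetLike.GradedSMul F G] {i j : ℕ} {x : R} {y : M} (hx : x ∈ prev F i) (hy : y ∈ G j) :
    x • y ∈ prev G (i + j) := by
  cases i with
  | zero => rw [(Submodule.mem_bot k).1 hx, zero_smul]; exact zero_mem _
  | succ i =>
    rw [show i + 1 + j = (i + j) + 1 by omega]
    exact SetLike.GradedSMul.smul_mem (A := F) (B := G) hx hy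

theorem smul_prev_right {F : ℕ → Submodule k R} {G : ℕ → Submodule k M}
    [SetLike.GradedSMul F G] {i j : ℕ} {x : R} {y : M} (hx : x ∈ F i) (hy : y ∈ prev G j) :
    x • y ∈ prev G (i + j) := by
  cases j with
  | zero => rw [(Submodule.mem_bot k).1 hy, smul_zero]; exact zero_mem _
  | succ j => exact SetLike.GradedSMul.smul_mem (A := F) (B := G) hx hy

/-- The action `F i / F (i-1) × G j / G (j-1) → G (i+j) / G (i+j-1)`, `(x̄, ȳ) ↦ (x y)‾`. -/
def pieceSMul (F : ℕ → Submodule k R) (G : ℕ → Submodule k M) [SetLike.GradedSMul F G]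
    (i j : ℕ) : Piece F i → Piece G j → Piece G (i + j) :=
  Quotient.map₂
    (fun x y => ⟨(x : R) • (y : M), SetLike.GradedSMul.smul_mem (A := F) (B := G) x.2 y.2⟩)
    (by
      intro x x' hx y y' hy
      have hx' : (x : R) - x' ∈ prev F i :=
        (Submodule.quotientRel_def ((prev F i).submoduleOf (F i))).1 hx
      have hy' : (y : M) - y' ∈ prev G j :=
        (Submodule.quotientRel_def ((prev G j).submoduleOf (G j))).1 hy
      refine (Submodule.quotientRel_def _).2 ?_
      change (x : R) • (y : M) - (x' : R) • (y' : M) ∈ prev G (i + j)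
      have e : (x : R) • (y : M) - (x' : R) • (y' : M)
          = ((x : R) - x') • (y : M) + (x' : R) • ((y : M) - y') := by
        rw [sub_smul, smul_sub]; abel
      rw [e]
      exact add_mem (smul_prev_left hx' y.2) (smul_prev_right x'.2 hy'))

theorem pieceSMul_mk (F : ℕ → Submodule k R) (G : ℕ → Submodule k M) [SetLike.GradedSMul F G]
    (i j : ℕ) (x : F i) (y : G j) :
    pieceSMul F G i j (toPiece F i x) (toPiece G j y) = toPiece G (i + j)
      ⟨(x : R) • (y : M), SetLike.GradedSMul.smul_mem (A := F) (B := G) x.2 y.2⟩ := rfl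

theorem gradedSMul_self (F : ℕ → Submodule k R) [SetLike.GradedMonoid F] :
    SetLike.GradedSMul F F :=
  ⟨fun _ _ _ _ hx hy => SetLike.mul_mem_graded hx hy⟩

/-- The products `x̄ ȳ = (x y)‾` on the pieces of a filtered ring, with unit `1̄`. -/
instance pieceGMonoid (F : ℕ → Submodule k R) [IsRingFiltration F (prev F)] :
    GradedMonoid.GMonoid (Piece F) :=
  haveI := gradedSMul_self F
  letI : GradedMonoid.GMul (Piece F) := ⟨fun {i j} => pieceSMul F F i j⟩
  letI : GradedMonoid.GOne (Piece F) := ⟨toPiece F 0 ⟨1, SetLike.one_mem_graded F⟩⟩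
  { one_mul := by
      rintro ⟨i, ⟨x⟩⟩
      exact mk_eq_mk F (zero_add i) _ _ (one_mul (x : R))
    mul_one := by
      rintro ⟨i, ⟨x⟩⟩
      exact mk_eq_mk F (add_zero i) _ _ (mul_one (x : R))
    mul_assoc := by
      rintro ⟨i, ⟨x⟩⟩ ⟨j, ⟨y⟩⟩ ⟨l, ⟨z⟩⟩
      exact mk_eq_mk F (add_assoc i j l) _ _ (mul_assoc (x : R) (y : R) (z : R)) }

/-- The graded ring structure on the pieces of a filtered ring. -/
instance pieceGRing (F : ℕ → Submodule k R) [IsRingFiltration F (prev F)] :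
    DirectSum.GRing (Piece F) :=
  { pieceGMonoid F with
    mul_zero := by
      rintro i j ⟨x⟩
      exact toPiece_eq F (x := ⟨_, _⟩) (y := 0) (by simp)
    zero_mul := by
      rintro i j ⟨y⟩
      exact toPiece_eq F (x := ⟨_, _⟩) (y := 0) (by simp)
    mul_add := by
      rintro i j ⟨x⟩ ⟨y⟩ ⟨z⟩
      exact congrArg (toPiece F (i + j)) (Subtype.ext (mul_add (x : R) (y : R) (z : R)))
    add_mul := by
      rintro i j ⟨x⟩ ⟨y⟩ ⟨z⟩
      exact congrArg (toPiece F (i + j)) (Subtype.ext (add_mul (x : R) (y : R) (z : R)))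
    natCast := fun n => n • toPiece F 0 ⟨1, SetLike.one_mem_graded F⟩
    natCast_zero := zero_smul _ _
    natCast_succ := fun n => succ_nsmul _ n
    intCast := fun n => n • toPiece F 0 ⟨1, SetLike.one_mem_graded F⟩
    intCast_ofNat := fun n => natCast_zsmul _ n
    intCast_negSucc_ofNat := fun n => negSucc_zsmul _ n }

/-- The graded module structure on the pieces of a filtered module: `x̄ ȳ = (x y)‾`. -/
instance pieceGmodule (F : ℕ → Submodule k R) [IsRingFiltration F (prev F)]
    (G : ℕ → Submodule k M) [IsModuleFiltration F (prev F) G (prev G)] :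
    DirectSum.Gmodule (Piece F) (Piece G) where
  smul {i j} := pieceSMul F G i j
  one_smul := by
    rintro ⟨i, ⟨x⟩⟩
    exact mk_eq_mk G (zero_add i) _ _ (one_smul R (x : M))
  mul_smul := by
    rintro ⟨i, ⟨x⟩⟩ ⟨j, ⟨y⟩⟩ ⟨l, ⟨z⟩⟩
    exact mk_eq_mk G (add_assoc i j l) _ _ (mul_smul (x : R) (y : R) (z : M))
  smul_add := by
    rintro i j ⟨x⟩ ⟨y⟩ ⟨z⟩
    exact congrArg (toPiece G (i + j)) (Subtype.ext (smul_add (x : R) (y : M) (z : M)))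
  smul_zero := by
    rintro i j ⟨x⟩
    exact toPiece_eq G (x := ⟨_, _⟩) (y := 0) (by simp)
  add_smul := by
    rintro i j ⟨x⟩ ⟨y⟩ ⟨z⟩
    exact congrArg (toPiece G (i + j)) (Subtype.ext (add_smul (x : R) (y : R) (z : M)))
  zero_smul := by
    rintro i j ⟨y⟩
    exact toPiece_eq G (x := ⟨_, _⟩) (y := 0) (by simp)

end Filt

/-! ### Vertex operator algebras and their admissible modules -/

/-- The Jacobi identity for `Y(·, z)` on `V` and `Y_M(·, z)` on `M`, written out in modes
(`Y(a, z) = ∑ aₙ z^(-n-1)`, where `VertexOperator.ncoeff` is the mode `aₙ`): for all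
`l, m, n ∈ ℤ`,
`∑ᵢ C(m,i) (a_{l+i} b)_{m+n-i} v
  = ∑ᵢ (-1)^i C(l,i) (a_{m+l-i} b_{n+i} v - (-1)^l b_{n+l-i} a_{m+i} v)`.
All sums are finite, because vertex operators take values in Laurent series. -/
def JacobiIdentity {V M : Type*} [AddCommGroup V] [Module ℂ V] [AddCommGroup M] [Module ℂ M]
    (Y : V →ₗ[ℂ] VertexOperator ℂ V) (YM : V →ₗ[ℂ] VertexOperator ℂ M) : Prop :=
  ∀ (a b : V) (v : M) (l m n : ℤ),
    ∑ᶠ i : ℕ, ((Ring.choose m i : ℤ) : ℂ) •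
        (YM ((Y a).ncoeff (l + i) b)).ncoeff (m + n - i) v
      = ∑ᶠ i : ℕ, ((-1 : ℂ) ^ i * ((Ring.choose l i : ℤ) : ℂ)) •
        ((YM a).ncoeff (m + l - i) ((YM b).ncoeff (n + i) v)
          - (-1 : ℂ) ^ l • (YM b).ncoeff (n + l - i) ((YM a).ncoeff (m + i) v))

/-- An `ℕ`-grading viewed as a `ℤ`-grading with zero components in negative degrees. -/
def intGrade {M : Type*} [AddCommGroup M] [Module ℂ M] (G : ℕ → Submodule ℂ M) :
    ℤ → Submodule ℂ M
  | Int.ofNat n => G n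
  | Int.negSucc _ => ⊥

/-- A vertex operator algebra `V = ⨁_{n ≥ 0} V_n` over `ℂ`, with `L(n) = ω_{n+1}`. -/
class VertexOperatorAlgebra (V : Type*) [AddCommGroup V] [Module ℂ V] where
  /-- the state-field correspondence `a ↦ Y(a, z)` -/
  Y : V →ₗ[ℂ] VertexOperator ℂ V
  /-- the vacuum vector `𝟏` -/
  vac : V
  /-- the conformal vector `ω` -/
  conf : V
  /-- the central charge -/
  centralCharge : ℂ
  /-- the homogeneous subspace `V_n` -/
  wt : ℕ → Submodule ℂ V
  isInternal : DirectSum.IsInternal wt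
  finiteDimensional : ∀ n, FiniteDimensional ℂ (wt n)
  vac_mem : vac ∈ wt 0
  conf_mem : conf ∈ wt 2
  vac_mode : ∀ (n : ℤ) (b : V), (Y vac).ncoeff n b = if n = -1 then b else 0
  mode_vac : ∀ (a : V) (n : ℤ), 0 ≤ n → (Y a).ncoeff n vac = 0
  mode_neg_one_vac : ∀ a : V, (Y a).ncoeff (-1) vac = a
  jacobi : JacobiIdentity Y Y
  virasoro : ∀ (m n : ℤ) (v : V),
    (Y conf).ncoeff (m + 1) ((Y conf).ncoeff (n + 1) v)
        - (Y conf).ncoeff (n + 1) ((Y conf).ncoeff (m + 1) v)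
      = ((m : ℂ) - n) • (Y conf).ncoeff (m + n + 1) v
        + if m + n = 0 then (((m : ℂ) ^ 3 - m) / 12 * centralCharge) • v else 0
  L_zero : ∀ (n : ℕ), ∀ a ∈ wt n, (Y conf).ncoeff 1 a = (n : ℂ) • a
  L_neg_one : ∀ (a b : V) (n : ℤ),
    (Y ((Y conf).ncoeff 0 a)).ncoeff n b = (-n : ℂ) • (Y a).ncoeff (n - 1) b

/-- `V` is of CFT type: `V_0 = ℂ 𝟏` (and `V_n = 0` for `n < 0`, which is built in above). -/
def VertexOperatorAlgebra.IsCFTType (V : Type*) [AddCommGroup V] [Module ℂ V]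
    [VertexOperatorAlgebra V] : Prop :=
  wt (V := V) 0 = Submodule.span ℂ {vac (V := V)}

/-- An admissible `V`-module `M = ⨁_{n ≥ 0} M(n)`. -/
class AdmissibleModule (V M : Type*) [AddCommGroup V] [Module ℂ V] [VertexOperatorAlgebra V]
    [AddCommGroup M] [Module ℂ M] where
  /-- the action `a ↦ Y_M(a, z)` -/
  Y : V →ₗ[ℂ] VertexOperator ℂ M
  /-- the homogeneous subspace `M(n)` -/
  deg : ℕ → Submodule ℂ M
  isInternal : DirectSum.IsInternal deg
  vac_mode : ∀ (n : ℤ) (v : M),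
    (Y (VertexOperatorAlgebra.vac (V := V))).ncoeff n v = if n = -1 then v else 0
  jacobi : JacobiIdentity (VertexOperatorAlgebra.Y (V := V)) Y
  /-- `a_n M(k) ⊆ M(wt a + k - n - 1)` -/
  mode_mem : ∀ (p : ℕ), ∀ a ∈ VertexOperatorAlgebra.wt (V := V) p, ∀ (n : ℤ) (k : ℕ),
    ∀ v ∈ deg k, (Y a).ncoeff n v ∈ intGrade deg (p + k - n - 1)

namespace VOA

open VertexOperatorAlgebra

variable (V M : Type*) [AddCommGroup V] [Module ℂ V] [VertexOperatorAlgebra V]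
  [AddCommGroup M] [Module ℂ M]

section Adjoint

variable {V M}

/-- `M = ⨁ G n` as an equivalence with the external direct sum. -/
def decomp {G : ℕ → Submodule ℂ M} (h : DirectSum.IsInternal G) : M ≃ₗ[ℂ] ⨁ n, G n :=
  (LinearEquiv.ofBijective (DirectSum.coeLinearMap G) h).symm

theorem decomp_symm_lof {G : ℕ → Submodule ℂ M} (h : DirectSum.IsInternal G) (n : ℕ) (x : G n) :
    (decomp h).symm (DirectSum.lof ℂ ℕ (fun n => G n) n x) = x :=
  DirectSum.coeLinearMap_lof G n x

theorem decomp_of_mem {G : ℕ → Submodule ℂ M} (h : DirectSum.IsInternal G) {n : ℕ} {x : M}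
    (hx : x ∈ G n) : decomp h x = DirectSum.lof ℂ ℕ (fun n => G n) n ⟨x, hx⟩ := by
  rw [← LinearEquiv.eq_symm_apply, decomp_symm_lof]

theorem grade_induction {G : ℕ → Submodule ℂ M} (h : DirectSum.IsInternal G) {p : M → Prop}
    (h0 : p 0) (hadd : ∀ x y, p x → p y → p (x + y)) (hG : ∀ n, ∀ x ∈ G n, p x) (x : M) : p x := by
  have hx : x ∈ ⨆ n, G n := by rw [h.submodule_iSup_eq_top]; trivial
  exact Submodule.iSup_induction G (motive := p) hx hG h0 hadd

/-- An eigenvector of `L(0)` with integral eigenvalue `c` is homogeneous of weight `c`. -/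
theorem mem_intGrade_of_L_zero {x : V} {c : ℤ} (hx : (Y (conf (V := V))).ncoeff 1 x = (c : ℂ) • x) :
    x ∈ intGrade (wt (V := V)) c := by
  set D := decomp (isInternal (V := V)) with hD
  have key : ∀ (y : V) (n : ℕ), ((D ((Y (conf (V := V))).ncoeff 1 y)) n : V)
      = (n : ℂ) • ((D y) n : V) := by
    intro y n
    refine grade_induction (isInternal (V := V))
      (p := fun y => ((D ((Y (conf (V := V))).ncoeff 1 y)) n : V) = (n : ℂ) • ((D y) n : V))
      (by simp) ?_ ?_ y
    · intro x y hx hy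
      simp only [map_add, DirectSum.add_apply, Submodule.coe_add, hx, hy, smul_add]
    · intro m x hx
      rw [L_zero m x hx, map_smul, hD, decomp_of_mem _ hx]
      simp only [DirectSum.smul_apply, Submodule.coe_smul]
      by_cases hmn : m = n
      · subst hmn; rfl
      · rw [DirectSum.lof_eq_of, DirectSum.of_eq_of_ne _ _ _ (Ne.symm hmn)]; simp
  have hz : ∀ n : ℕ, (n : ℤ) ≠ c → D x n = 0 := by
    intro n hn
    have h1 := key x n
    rw [hx, map_smul, DirectSum.smul_apply, Submodule.coe_smul, ← sub_eq_zero, ← sub_smul] at h1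
    rcases smul_eq_zero.1 h1 with h2 | h2
    · exact absurd (by exact_mod_cast (sub_eq_zero.1 h2).symm) hn
    · exact Subtype.ext h2
  have hxD : x = D.symm (D x) := (D.symm_apply_apply x).symm
  rcases c with c | c
  · have : D x = DirectSum.lof ℂ ℕ (fun n => wt (V := V) n) c (D x c) := by
      refine DFinsupp.ext fun n => ?_
      by_cases hn : n = c
      · subst hn
        exact (DirectSum.lof_apply (R := ℂ) (M := fun n => wt (V := V) n) n _).symm
      · rw [hz n (by simpa using hn), DirectSum.lof_eq_of, DirectSum.of_eq_of_ne _ _ _ hn]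
    rw [hxD, this]
    rw [hD, decomp_symm_lof]
    exact Subtype.property _
  · have : D x = 0 := DFinsupp.ext fun n => hz n (by simp)
    rw [hxD, this]
    simp

theorem mode_mem_intGrade (p : ℕ) (a : V) (ha : a ∈ wt p) (n : ℤ) (k : ℕ) (v : V)
    (hv : v ∈ wt k) : (Y a).ncoeff n v ∈ intGrade (wt (V := V)) (p + k - n - 1) := by
  apply mem_intGrade_of_L_zero
  have h := jacobi (V := V) conf a v 0 1 n
  rw [finsum_eq_sum_of_support_subset (s := Finset.range 2),
    finsum_eq_sum_of_support_subset (s := Finset.range 1)] at h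
  · simp only [Finset.sum_range_succ, Finset.sum_range_zero, Nat.cast_zero, Nat.cast_one,
      Ring.choose_zero_right, Ring.choose_one_right, zero_add, add_zero, sub_zero, pow_zero,
      zpow_zero, mul_one, one_smul, Int.cast_one, L_neg_one, L_zero p a ha,
      L_zero k v hv, map_smul, LinearMap.smul_apply, Pi.smul_apply] at h
    rw [eq_comm, sub_eq_iff_eq_add] at h
    rw [h, show (1 : ℤ) + n - 1 = n by ring, show (1 : ℤ) + n = n + 1 by ring]
    simp only [← add_smul]
    congr 1
    push_cast
    ring
  · intro i hi
    by_contra hi'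
    have : i ≠ 0 := by simpa using hi'
    exact hi (by simp [Ring.choose_zero_pos ℤ (Nat.pos_of_ne_zero this)])
  · intro i hi
    by_contra hi'
    have h2 : 1 < i := by simpa using hi'
    refine hi ?_
    have : Ring.choose (1 : ℤ) i = 0 := by
      have := Ring.choose_natCast (R := ℤ) 1 i
      rw [Nat.choose_eq_zero_of_lt h2] at this
      exact_mod_cast this
    simp [this]

/-- `V` as an admissible module over itself. -/
instance adjoint : AdmissibleModule V V where
  Y := Y
  deg := wt
  isInternal := isInternal
  vac_mode := vac_mode
  jacobi := jacobi
  mode_mem := mode_mem_intGrade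

end Adjoint

variable [AdmissibleModule V M]

/-- The mode `a_n v`, bilinear in `a ∈ V` and `v ∈ M`. -/
def mode (n : ℤ) : V →ₗ[ℂ] M →ₗ[ℂ] M :=
  (LinearMap.proj n).comp (VertexOperator.ncoeff.comp (AdmissibleModule.Y (V := V) (M := M)))

/-- The spanning elements `a¹_{-n₁} ⋯ aᵏ_{-n_k} w` with `k ≥ 0`, `aⁱ ∈ V_+` homogeneous,
`nᵢ ≥ 1` and `w ∈ W`. -/
inductive IsWord (W : Set M) : M → Prop
  | base (w : M) (hw : w ∈ W) : IsWord W w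
  | step (p : ℕ) (hp : 1 ≤ p) (a : V) (ha : a ∈ wt p) (n : ℕ) (hn : 1 ≤ n) (x : M)
      (hx : IsWord W x) : IsWord W (mode V M (-n) a x)

/-- `M` is strongly generated by the subset `W`. -/
def StronglyGeneratedBy (W : Set M) : Prop :=
  Submodule.span ℂ {x : M | IsWord V M W x} = ⊤

/-- `M` is strongly finitely generated. -/
def StronglyFinitelyGenerated : Prop :=
  ∃ W : Set M, W.Finite ∧ StronglyGeneratedBy V M W

/-- `C₂(M)`, spanned by all `a_{-2} v`. -/
def C2 : Submodule ℂ M :=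
  Submodule.span ℂ {x : M | ∃ (a : V) (v : M), x = mode V M (-2) a v}

/-- `Res_z (1+z)^p z^k Y_M(a, z) v = ∑_j C(p,j) a_{k+j} v`. -/
def res (p : ℕ) (k : ℤ) : V →ₗ[ℂ] M →ₗ[ℂ] M :=
  ∑ j ∈ Finset.range (p + 1), (p.choose j : ℂ) • mode V M (k + j)

/-- `O(M)`, spanned by `Res_z Y_M(a, z) v (1+z)^{wt a} / z²` for `a ∈ V` homogeneous, `v ∈ M`. -/
def O : Submodule ℂ M :=
  Submodule.span ℂ {x : M | ∃ (p : ℕ) (a : V) (v : M), a ∈ wt p ∧ x = res V M p (-2) a v}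

/-- The product `a ∗ v = Res_z Y_M(a, z) v (1+z)^{wt a} / z` for `a` homogeneous,
extended linearly to all `a ∈ V`. -/
def star : V →ₗ[ℂ] M →ₗ[ℂ] M :=
  (DirectSum.toModule ℂ ℕ (M →ₗ[ℂ] M)
    (fun p => (res V M p (-1)).comp (wt (V := V) p).subtype)).comp
    (decomp (isInternal (V := V))).toLinearMap

variable {V M}

theorem star_of_mem {p : ℕ} {a : V} (ha : a ∈ wt p) (v : M) :
    star V M a v = res V M p (-1) a v := by
  simp [star, decomp_of_mem _ ha]

/-! #### Zhu's algebra is associative and `A(M)` is a module over it -/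

theorem mem_intGrade_cast {G : ℕ → Submodule ℂ M} {x : M} {c : ℤ} {n : ℕ} (h : c = n)
    (hx : x ∈ intGrade G c) : x ∈ G n := by
  subst h
  exact hx

theorem mode_mem_deg {p k n : ℕ} {c : ℤ} {a : V} {v : M} (ha : a ∈ wt p)
    (hv : v ∈ AdmissibleModule.deg V k) (h : (p : ℤ) + k - c - 1 = n) :
    mode V M c a v ∈ AdmissibleModule.deg V n :=
  mem_intGrade_cast h (AdmissibleModule.mode_mem p a ha c k v hv)

theorem mode_mem_wt {p k n : ℕ} {c : ℤ} {a b : V} (ha : a ∈ wt p)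
    (hb : b ∈ wt k) (h : (p : ℤ) + k - c - 1 = n) : mode V V c a b ∈ wt n :=
  mode_mem_deg (M := V) ha hb h

theorem mode_truncation (a : V) (v : M) : ∃ N : ℤ, ∀ n : ℤ, N ≤ n → mode V M n a v = 0 := by
  set A := AdmissibleModule.Y (M := M) a
  refine ⟨-HahnSeries.order ((HahnModule.of ℂ).symm (A v)), fun n hn => ?_⟩
  exact VertexOperator.ncoeff_eq_zero_of_lt_order A n v (by omega)

theorem vac_mode_eq (n : ℤ) (v : M) :
    mode V M n (vac (V := V)) v = if n = -1 then v else 0 :=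
  AdmissibleModule.vac_mode n v

/-- The Jacobi identity with explicit finite ranges of summation. -/
theorem jacobi_finite (a b : V) (v : M) (l k : ℤ) : ∃ N : ℕ, ∀ p m t : ℕ, m ≤ p →
    ∑ i ∈ Finset.range (p + 1), (m.choose i : ℂ) •
        mode V M (m + (k + t) - i) (mode V V (l + i) a b) v
      = ∑ i ∈ Finset.range (N + 1), ((-1 : ℂ) ^ i * ((Ring.choose l i : ℤ) : ℂ)) •
        (mode V M (m + l - i) a (mode V M (k + t + i) b v)
          - (-1 : ℂ) ^ l • mode V M (k + t + l - i) b (mode V M (m + i) a v)) := by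
  obtain ⟨N1, h1⟩ := mode_truncation a v
  obtain ⟨N2, h2⟩ := mode_truncation b v
  refine ⟨max N1.toNat (N2 - k).toNat, fun p m t hm => ?_⟩
  have h := AdmissibleModule.jacobi (V := V) (M := M) a b v l m (k + t)
  rw [finsum_eq_sum_of_support_subset (s := Finset.range (p + 1)),
    finsum_eq_sum_of_support_subset (s := Finset.range (max N1.toNat (N2 - k).toNat + 1))] at h
  · simp only [Ring.choose_natCast] at h
    exact_mod_cast h
  · intro i hi
    by_contra hi'
    have h3 : max N1.toNat (N2 - k).toNat + 1 ≤ i := by simpa using hi'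
    refine hi ?_
    have e1 : mode V M (m + i) a v = 0 := h1 _ (by omega)
    have e2 : mode V M (k + t + i) b v = 0 := h2 _ (by omega)
    change _ • (mode V M _ a (mode V M (k + t + i) b v)
      - _ • mode V M _ b (mode V M (m + i) a v)) = 0
    rw [e1, e2]
    simp
  · intro i hi
    by_contra hi'
    have h3 : p + 1 ≤ i := by simpa using hi'
    refine hi ?_
    simp [Ring.choose_natCast, Nat.choose_eq_zero_of_lt (show m < i by omega)]

/-- Binomial sums `∑_s C(n,s) X_s`. -/
def bsum (n : ℕ) (X : ℕ → M) : M := ∑ s ∈ Finset.range (n + 1), (n.choose s : ℂ) • X s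

theorem bsum_succ (n : ℕ) (X : ℕ → M) :
    bsum (n + 1) X = bsum n X + bsum n (fun s => X (s + 1)) := by
  have h : bsum n X = ∑ s ∈ Finset.range (n + 2), (n.choose s : ℂ) • X s := by
    rw [Finset.sum_range_succ]; simp [bsum]
  rw [h, bsum, bsum, Finset.sum_range_succ', Finset.sum_range_succ' (n := n + 1)]
  simp only [Nat.choose_succ_succ, Nat.cast_add, add_smul, Finset.sum_add_distrib,
    Nat.choose_zero_right]
  abel

theorem bsum_add_apply (n : ℕ) (X Z : ℕ → M) :
    bsum n (fun s => X s + Z s) = bsum n X + bsum n Z := by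
  simp [bsum, Finset.sum_add_distrib]

theorem bsum_smul (n : ℕ) (c : ℂ) (X : ℕ → M) :
    bsum n (fun s => c • X s) = c • bsum n X := by
  simp [bsum, Finset.smul_sum, smul_comm c]

theorem bsum_bsum (n m : ℕ) (X : ℕ → M) :
    bsum n (fun u => bsum m (fun t => X (u + t))) = bsum (n + m) X := by
  induction n generalizing X with
  | zero => simp [bsum]
  | succ n ih =>
    rw [bsum_succ, ih, show n + 1 + m = n + m + 1 by omega, bsum_succ, ← ih (fun s => X (s + 1))]
    congr 2
    funext u
    congr 1
    funext t
    congr 1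
    omega

theorem bsum_mul_index (n : ℕ) (X : ℕ → M) :
    bsum (n + 1) (fun s => (s : ℂ) • X s) = ((n : ℂ) + 1) • bsum n (fun s => X (s + 1)) := by
  rw [bsum, Finset.sum_range_succ', bsum, Finset.smul_sum]
  simp only [Nat.cast_zero, zero_smul, smul_zero, add_zero, smul_smul]
  refine Finset.sum_congr rfl fun s _ => ?_
  congr 1
  exact_mod_cast (Nat.add_one_mul_choose_eq n s).symm

theorem bsum_choose (p i : ℕ) (hi : i ≤ p) (X : ℕ → M) :
    ∑ m ∈ Finset.range (p + 1), (p.choose m : ℂ) • (m.choose i : ℂ) • X m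
      = (p.choose i : ℂ) • bsum (p - i) (fun u => X (i + u)) := by
  rw [show p + 1 = i + (p - i + 1) by omega, Finset.sum_range_add, bsum, Finset.smul_sum]
  rw [Finset.sum_eq_zero (s := Finset.range i), zero_add]
  · refine Finset.sum_congr rfl fun u hu => ?_
    have hu' : u ≤ p - i := by simpa [Nat.lt_succ_iff] using hu
    rw [smul_smul, smul_smul]
    congr 1
    have := Nat.choose_mul (n := p) (k := i + u) (s := i) (by omega)
    rw [show i + u - i = u by omega] at this
    exact_mod_cast this
  · intro m hm
    simp [Nat.choose_eq_zero_of_lt (Finset.mem_range.1 hm)]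

theorem res_apply (p : ℕ) (k : ℤ) (a : V) (v : M) :
    res V M p k a v = bsum p (fun s => mode V M (k + s) a v) := by
  simp [res, bsum]

theorem res_succ (p : ℕ) (k : ℤ) (a : V) (v : M) :
    res V M (p + 1) k a v = res V M p k a v + res V M p (k + 1) a v := by
  simp only [res_apply, bsum_succ]
  congr 2
  funext s
  push_cast
  congr 3
  ring

/-- The residue form of the Jacobi identity against `(1+z₁)^p (1+z₂)^e z₂^k (z₁-z₂)^l`. -/
theorem res_jacobi (a b : V) (v : M) (l k : ℤ) (p e : ℕ) : ∃ N : ℕ,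
    ∑ j ∈ Finset.range (p + 1), (p.choose j : ℂ) •
        res V M (p + e - j) k (mode V V (l + j) a b) v
      = ∑ i ∈ Finset.range (N + 1), ((-1 : ℂ) ^ i * ((Ring.choose l i : ℤ) : ℂ)) •
        (res V M p (l - i) a (res V M e (k + i) b v)
          - (-1 : ℂ) ^ l • res V M e (k + l - i) b (res V M p i a v)) := by
  obtain ⟨N, hN⟩ := jacobi_finite a b v l k
  refine ⟨N, ?_⟩
  have h : bsum p (fun m => bsum e (fun t => ∑ i ∈ Finset.range (p + 1), (m.choose i : ℂ) •
        mode V M (m + (k + t) - i) (mode V V (l + i) a b) v))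
      = bsum p (fun m => bsum e (fun t => ∑ i ∈ Finset.range (N + 1),
        ((-1 : ℂ) ^ i * ((Ring.choose l i : ℤ) : ℂ)) •
        (mode V M (m + l - i) a (mode V M (k + t + i) b v)
          - (-1 : ℂ) ^ l • mode V M (k + t + l - i) b (mode V M (m + i) a v)))) := by
    refine Finset.sum_congr rfl fun m hm => ?_
    congr 1
    refine Finset.sum_congr rfl fun t _ => ?_
    exact congrArg _ (hN p m t (by simpa [Nat.lt_succ_iff] using hm))
  have sum_out : ∀ (s : Finset ℕ) (n : ℕ) (X : ℕ → ℕ → M),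
      bsum n (fun u => ∑ i ∈ s, X i u) = ∑ i ∈ s, bsum n (X i) := by
    intro s n X
    simp only [bsum, Finset.smul_sum]
    exact Finset.sum_comm
  have bsub : ∀ (n : ℕ) (X Z : ℕ → M),
      bsum n (fun s => X s - Z s) = bsum n X - bsum n Z := by
    intro n X Z
    simp [bsum, smul_sub, Finset.sum_sub_distrib]
  have bmap : ∀ (n : ℕ) (f : M →ₗ[ℂ] M) (X : ℕ → M),
      bsum n (fun s => f (X s)) = f (bsum n X) := by
    intro n f X
    simp [bsum]
  have bcomm : ∀ (n m : ℕ) (X : ℕ → ℕ → M),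
      bsum n (fun u => bsum m (fun t => X u t)) = bsum m (fun t => bsum n (fun u => X u t)) := by
    intro n m X
    simp only [bsum, Finset.smul_sum]
    rw [Finset.sum_comm]
    exact Finset.sum_congr rfl fun _ _ => Finset.sum_congr rfl fun _ _ => smul_comm _ _ _
  simp only [sum_out, bsum_smul, bsub] at h
  refine Eq.trans ?_ (h.trans ?_)
  · refine Finset.sum_congr rfl fun i hi => ?_
    have hi' : i ≤ p := by simpa [Nat.lt_succ_iff] using hi
    rw [bsum, bsum_choose p i hi', res_apply, show p + e - i = (p - i) + e by omega, ← bsum_bsum]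
    congr 2
    funext u
    congr 1
    funext t
    congr 3
    push_cast
    ring
  · refine Finset.sum_congr rfl fun i _ => ?_
    congr 2
    · rw [res_apply]
      congr 1
      funext m
      rw [res_apply, ← bmap, show (l - i + m : ℤ) = m + l - i by ring]
      congr 1
      funext t
      rw [show (k + i + t : ℤ) = k + t + i by ring]
    · rw [bcomm, res_apply]
      congr 2
      funext t
      rw [res_apply, ← bmap, show (k + l - i + t : ℤ) = k + t + l - i by ring]
      congr 1
      funext m
      rw [show (i + m : ℤ) = m + i by ring]

/-- `(a_{-2} 𝟏)_n = -n a_{n-1}`. -/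
theorem mode_derivative (a : V) (n : ℤ) (v : M) :
    mode V M n (mode V V (-2) a vac) v = (-n : ℂ) • mode V M (n - 1) a v := by
  have hc : ∀ i : ℕ, (-1 : ℂ) ^ i * ((Ring.choose (-2 : ℤ) i : ℤ) : ℂ) = i + 1 := by
    intro i
    rw [Ring.choose_neg, ← Ring.multichoose_eq, Ring.multichoose_two]
    rcases Nat.even_or_odd i with h | h
    · simp [h, Int.negOnePow_even]
    · simp [h, Int.negOnePow_odd, add_comm]
  have h := AdmissibleModule.jacobi (V := V) (M := M) a vac v (-2) 0 n
  have hl : ∑ᶠ i : ℕ, ((Ring.choose (0 : ℤ) i : ℤ) : ℂ) •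
      mode V M (0 + n - i) (mode V V (-2 + i) a vac) v
      = mode V M n (mode V V (-2) a vac) v := by
    rw [finsum_eq_single _ 0]
    · simp
    · intro i hi
      simp [Ring.choose_zero_pos ℤ (Nat.pos_of_ne_zero hi)]
  rw [← hl]
  refine h.trans ?_
  change ∑ᶠ i : ℕ, ((-1 : ℂ) ^ i * ((Ring.choose (-2 : ℤ) i : ℤ) : ℂ)) •
      (mode V M (0 + -2 - i) a (mode V M (n + i) vac v)
        - (-1 : ℂ) ^ (-2 : ℤ) • mode V M (n + -2 - i) vac (mode V M (0 + i) a v)) = _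
  simp only [hc, vac_mode_eq]
  rcases lt_trichotomy n 0 with hn | hn | hn
  · obtain ⟨j, hj⟩ := Int.eq_ofNat_of_zero_le (show 0 ≤ -1 - n by omega)
    obtain rfl : n = -1 - j := by omega
    rw [finsum_eq_single _ j]
    · rw [if_pos (by ring), if_neg (by omega), smul_zero, sub_zero,
        show (0 + -2 - j : ℤ) = -1 - j - 1 by ring]
      congr 1
      push_cast
      ring
    · intro i hi
      rw [if_neg (by omega), if_neg (by omega)]
      simp
  · subst hn
    rw [finsum_eq_zero_of_forall_eq_zero]
    · simp
    · intro i
      rw [if_neg (by omega), if_neg (by omega)]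
      simp
  · obtain ⟨j, hj⟩ := Int.eq_ofNat_of_zero_le (show 0 ≤ n - 1 by omega)
    obtain rfl : n = j + 1 := by omega
    rw [finsum_eq_single _ j]
    · rw [if_neg (by omega), if_pos (by ring), map_zero, zero_sub,
        show (0 + j : ℤ) = j + 1 - 1 by ring, smul_neg, ← neg_smul, smul_smul]
      congr 1
      push_cast
      norm_num
    · intro i hi
      rw [if_neg (by omega), if_neg (by omega)]
      simp

theorem res_mem_O {p : ℕ} {a : V} (ha : a ∈ wt p) (m : ℕ) (v : M) :
    res V M p (-2 - m) a v ∈ O V M := by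
  induction m generalizing p a with
  | zero => exact Submodule.subset_span ⟨p, a, v, ha, by simp⟩
  | succ m ih =>
    have ha' : mode V V (-2) a vac ∈ wt (p + 1) :=
      mode_mem_wt ha vac_mem (by push_cast; ring)
    set X : ℕ → M := fun s => mode V M (-2 - (m + 1 : ℕ) + s) a v with hX
    have e1 : res V M (p + 1) (-2 - m) (mode V V (-2) a vac) v
        = ((m : ℂ) + 2) • bsum (p + 1) X
          - bsum (p + 1) (fun s => (s : ℂ) • X s) := by
      rw [res_apply, bsum, bsum, bsum, Finset.smul_sum, ← Finset.sum_sub_distrib]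
      refine Finset.sum_congr rfl fun s _ => ?_
      rw [mode_derivative, hX,
        show (-2 - (m : ℤ) + s - 1) = -2 - ((m + 1 : ℕ) : ℤ) + s by push_cast; ring]
      simp only [smul_smul, ← sub_smul]
      congr 1
      push_cast
      ring
    have e2 : res V M p (-2 - m) a v = bsum p (fun s => X (s + 1)) := by
      rw [res_apply]
      congr 1
      funext s
      rw [hX]
      congr 3
      push_cast
      ring
    have e3 : res V M p (-2 - (m + 1 : ℕ)) a v = bsum p X := res_apply _ _ _ _
    rw [bsum_mul_index, bsum_succ, ← e2, ← e3] at e1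
    have h1 := ih ha'
    have h2 := ih ha
    have e4 : ((m : ℂ) + 2) • res V M p (-2 - (m + 1 : ℕ)) a v
        = res V M (p + 1) (-2 - m) (mode V V (-2) a vac) v
          - ((m : ℂ) + 2 - (p + 1)) • res V M p (-2 - m) a v := by
      rw [e1]
      module
    have h3 : ((m : ℂ) + 2) • res V M p (-2 - (m + 1 : ℕ)) a v ∈ O V M := by
      rw [e4]
      exact sub_mem h1 (Submodule.smul_mem _ _ h2)
    exact (Submodule.smul_mem_iff _ (by exact_mod_cast (show m + 2 ≠ 0 by omega))).1 h3

theorem res_mem_O_of_le {p : ℕ} {a : V} (ha : a ∈ wt p) {c : ℤ} (hc : c ≤ -2) (v : M) :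
    res V M p c a v ∈ O V M := by
  obtain ⟨m, hm⟩ := Int.eq_ofNat_of_zero_le (show 0 ≤ -2 - c by omega)
  obtain rfl : c = -2 - m := by omega
  exact res_mem_O ha m v

theorem star_res_sub_mem {p q : ℕ} {a b : V} (ha : a ∈ wt p) (hb : b ∈ wt q) {k : ℤ}
    (hk : k ≤ -1) (v : M) :
    ∑ j ∈ Finset.range (p + 1), (p.choose j : ℂ) •
        res V M (p + q - j) k (mode V V (-1 + j) a b) v
      - star V M a (res V M q k b v) ∈ O V M := by
  obtain ⟨N, hN⟩ := res_jacobi a b v (-1) k p q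
  rw [hN, star_of_mem ha, Finset.sum_range_succ', add_sub_assoc]
  refine add_mem (Submodule.sum_mem _ fun i _ => Submodule.smul_mem _ _
    (sub_mem (res_mem_O_of_le ha (by push_cast; omega) _)
      (Submodule.smul_mem _ _ (res_mem_O_of_le hb (by push_cast; omega) _)))) ?_
  simp only [Nat.cast_zero, pow_zero, Ring.choose_zero_right, Int.cast_one, mul_one, one_smul,
    sub_zero, add_zero]
  rw [sub_right_comm, sub_self, zero_sub]
  exact neg_mem (Submodule.smul_mem _ _ (res_mem_O_of_le hb (by omega) _))

theorem star_assoc (a b : V) (v : M) :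
    star V M (star V V a b) v - star V M a (star V M b v) ∈ O V M := by
  refine grade_induction (isInternal (V := V))
    (p := fun a => star V M (star V V a b) v - star V M a (star V M b v) ∈ O V M)
    (by simp) ?_ ?_ a
  · intro x y hx hy
    simp only [map_add, LinearMap.add_apply, add_sub_add_comm]
    exact add_mem hx hy
  intro p a ha
  refine grade_induction (isInternal (V := V))
    (p := fun b => star V M (star V V a b) v - star V M a (star V M b v) ∈ O V M)
    (by simp) ?_ ?_ b
  · intro x y hx hy
    simp only [map_add, LinearMap.add_apply, add_sub_add_comm]
    exact add_mem hx hy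
  intro q b hb
  have h := star_res_sub_mem ha hb (k := -1) le_rfl v
  rw [star_of_mem hb]
  convert h using 2
  rw [star_of_mem ha, res, LinearMap.sum_apply, LinearMap.sum_apply, map_sum, LinearMap.sum_apply]
  refine Finset.sum_congr rfl fun j hj => ?_
  have hj' : j ≤ p := by simpa [Nat.lt_succ_iff] using hj
  simp only [LinearMap.smul_apply, map_smul]
  rw [star_of_mem (mode_mem_wt ha hb (n := p + q - j) (by omega))]

theorem star_mem_O (a : V) {x : M} (hx : x ∈ O V M) : star V M a x ∈ O V M := by
  refine grade_induction (isInternal (V := V)) (p := fun a => star V M a x ∈ O V M)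
    (by simp) (fun x y hx hy => by simpa using add_mem hx hy) ?_ a
  intro p a ha
  suffices h : O V M ≤ (O V M).comap (star V M a) from h hx
  refine Submodule.span_le.2 ?_
  rintro _ ⟨q, b, v, hb, rfl⟩
  have h := star_res_sub_mem ha hb (k := -2) (by omega) v
  refine (Submodule.sub_mem_iff_right (O V M) (Submodule.sum_mem _ fun j hj => ?_)).1 h
  have hj' : j ≤ p := by simpa [Nat.lt_succ_iff] using hj
  exact Submodule.smul_mem _ _
    (res_mem_O_of_le (mode_mem_wt ha hb (n := p + q - j) (by omega)) le_rfl v)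

theorem O_star_mem {x : V} (hx : x ∈ O V V) (v : M) : star V M x v ∈ O V M := by
  suffices h : O V V ≤ (O V M).comap ((star V M).flip v) from h hx
  refine Submodule.span_le.2 ?_
  rintro _ ⟨p, a, b, ha, rfl⟩
  change star V M (res V V p (-2) a b) v ∈ O V M
  refine grade_induction (isInternal (V := V))
    (p := fun b => star V M (res V V p (-2) a b) v ∈ O V M)
    (by simp) (fun x y hx hy => by simpa using add_mem hx hy) ?_ b
  intro q b hb
  obtain ⟨N, hN⟩ := res_jacobi a b v (-2) (-1) p (q + 1)
  have e : star V M (res V V p (-2) a b) v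
      = ∑ j ∈ Finset.range (p + 1), (p.choose j : ℂ) •
        res V M (p + (q + 1) - j) (-1) (mode V V (-2 + j) a b) v := by
    rw [res, LinearMap.sum_apply, LinearMap.sum_apply, map_sum, LinearMap.sum_apply]
    refine Finset.sum_congr rfl fun j hj => ?_
    have hj' : j ≤ p := by simpa [Nat.lt_succ_iff] using hj
    simp only [LinearMap.smul_apply, map_smul]
    rw [star_of_mem (mode_mem_wt ha hb (n := p + (q + 1) - j) (by omega))]
  rw [e, hN]
  refine Submodule.sum_mem _ fun i _ => Submodule.smul_mem _ _
    (sub_mem (res_mem_O_of_le ha (by omega) _) (Submodule.smul_mem _ _ ?_))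
  rw [res_succ]
  exact add_mem (res_mem_O_of_le hb (by omega) _) (res_mem_O_of_le hb (by omega) _)

theorem vac_star (v : M) : star V M vac v = v := by
  rw [star_of_mem vac_mem]
  simp [res, vac_mode_eq]

theorem star_vac (a : V) : star V V a vac = a := by
  refine grade_induction (isInternal (V := V)) (p := fun a => star V V a vac = a)
    (by simp) (fun x y hx hy => by simp [hx, hy]) ?_ a
  intro p a ha
  rw [star_of_mem ha, res, LinearMap.sum_apply, LinearMap.sum_apply, Finset.sum_eq_single 0]
  · have : mode V V (-1) a vac = a := mode_neg_one_vac a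
    simp [this]
  · intro j _ hj
    have : mode V V (-1 + j) a vac = 0 := mode_vac a _ (by omega)
    simp [this]
  · simp

variable (V M)

/-- Zhu's algebra `A(V) = V / O(V)`. -/
def ZhuAlgebra : Type _ := V ⧸ O V V

/-- The left `A(V)`-module `A(M) = M / O(M)`. -/
def ZhuModule : Type _ := M ⧸ O V M

instance : AddCommGroup (ZhuAlgebra V) := inferInstanceAs (AddCommGroup (V ⧸ O V V))

instance : Module ℂ (ZhuAlgebra V) := inferInstanceAs (Module ℂ (V ⧸ O V V))

instance : AddCommGroup (ZhuModule V M) := inferInstanceAs (AddCommGroup (M ⧸ O V M))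

instance : Module ℂ (ZhuModule V M) := inferInstanceAs (Module ℂ (M ⧸ O V M))

/-- The projection `V → A(V)`. -/
def toZhuAlgebra : V →ₗ[ℂ] ZhuAlgebra V := (O V V).mkQ

/-- The projection `M → A(M)`. -/
def toZhuModule : M →ₗ[ℂ] ZhuModule V M := (O V M).mkQ

/-- The map `A(V) × A(M) → A(M)` induced by `a ∗ v`. -/
def act : (V ⧸ O V V) →ₗ[ℂ] (M ⧸ O V M) →ₗ[ℂ] (M ⧸ O V M) :=
  (O V V).liftQ
    { toFun := fun a => (O V M).mapQ (O V M) (star V M a) (fun _ hx => star_mem_O a hx)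
      map_add' := fun a b => by ext v; simp
      map_smul' := fun c a => by ext v; simp }
    (fun x hx => by
      ext v
      simpa using O_star_mem hx v)

/-- `A(V)` with the product `∗` is an associative ring with unit `𝟏 + O(V)`. -/
instance : Ring (ZhuAlgebra V) :=
  { (inferInstance : AddCommGroup (ZhuAlgebra V)) with
    mul := fun x y => act V V x y
    one := toZhuAlgebra V vac
    left_distrib := fun x y z => map_add (act V V x) y z
    right_distrib := fun x y z => LinearMap.map_add₂ (act V V) x y z
    zero_mul := fun x => LinearMap.map_zero₂ (act V V) x
    mul_zero := fun x => map_zero (act V V x)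
    one_mul := by
      rintro ⟨x⟩
      exact congrArg (toZhuAlgebra V) (vac_star x)
    mul_one := by
      rintro ⟨x⟩
      exact congrArg (toZhuAlgebra V) (star_vac x)
    mul_assoc := by
      rintro ⟨x⟩ ⟨y⟩ ⟨z⟩
      exact (Submodule.Quotient.eq _).2 (star_assoc x y z) }

/-- `A(M)` is a left `A(V)`-module under `a ∗ v`. -/
instance : Module (ZhuAlgebra V) (ZhuModule V M) where
  smul x y := act V M x y
  one_smul := by
    rintro ⟨x⟩
    exact congrArg (toZhuModule V M) (vac_star x)
  mul_smul := by
    rintro ⟨x⟩ ⟨y⟩ ⟨z⟩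
    exact (Submodule.Quotient.eq _).2 (star_assoc x y z)
  smul_zero x := map_zero (act V M x)
  smul_add x y z := map_add (act V M x) y z
  add_smul x y z := LinearMap.map_add₂ (act V M) x y z
  zero_smul x := LinearMap.map_zero₂ (act V M) x

/-! #### The filtrations and the associated graded objects -/

/-- `⨁_{i ≤ n} G i`. -/
def upTo {M : Type*} [AddCommGroup M] [Module ℂ M] (G : ℕ → Submodule ℂ M) (n : ℕ) :
    Submodule ℂ M :=
  ⨆ i ∈ Finset.range (n + 1), G i

/-- `A(V)_n`, the image of `⨁_{i ≤ n} V_i` in `A(V)`. -/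
def algFil (n : ℕ) : Submodule ℂ (ZhuAlgebra V) := (upTo (wt (V := V)) n).map (toZhuAlgebra V)

/-- `A(M)_n`, the image of `⨁_{i ≤ n} M(i)` in `A(M)`. -/
def modFil (n : ℕ) : Submodule ℂ (ZhuModule V M) :=
  (upTo (AdmissibleModule.deg (M := M) V) n).map (toZhuModule V M)

theorem le_upTo {G : ℕ → Submodule ℂ M} {i n : ℕ} (h : i ≤ n) : G i ≤ upTo G n :=
  le_iSup₂_of_le (f := fun i (_ : i ∈ Finset.range (n + 1)) => G i) i
    (Finset.mem_range.2 (by omega)) le_rfl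

theorem upTo_mono (G : ℕ → Submodule ℂ M) : Monotone (upTo G) := fun _ _ h =>
  iSup₂_le fun _ hi => le_upTo M (by have := Finset.mem_range.1 hi; omega)

theorem intGrade_le_upTo {G : ℕ → Submodule ℂ M} {c : ℤ} {n : ℕ} (h : c ≤ n) :
    intGrade G c ≤ upTo G n := by
  rcases c with c | c
  · exact le_upTo M (by simpa using h)
  · exact bot_le

theorem star_mem_upTo {m n : ℕ} {a : V} {v : M} (ha : a ∈ upTo (wt (V := V)) m)
    (hv : v ∈ upTo (AdmissibleModule.deg (M := M) V) n) :
    star V M a v ∈ upTo (AdmissibleModule.deg (M := M) V) (m + n) := by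
  set D := upTo (AdmissibleModule.deg (M := M) V) (m + n)
  suffices h : upTo (wt (V := V)) m ≤ D.comap ((star V M).flip v) from h ha
  refine iSup₂_le fun p hp a ha => ?_
  suffices h : upTo (AdmissibleModule.deg (M := M) V) n ≤ D.comap (star V M a) from h hv
  refine iSup₂_le fun k hk v hv => ?_
  have hp' := Finset.mem_range.1 hp
  have hk' := Finset.mem_range.1 hk
  change star V M a v ∈ D
  rw [star_of_mem ha, res, LinearMap.sum_apply, LinearMap.sum_apply]
  refine Submodule.sum_mem _ fun j _ => Submodule.smul_mem _ _ ?_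
  exact intGrade_le_upTo M (by omega) (AdmissibleModule.mode_mem p a ha (-1 + j) k v hv)

instance : IsRingFiltration (algFil V) (Filt.prev (algFil V)) where
  toIsFiltration := Filt.isFiltration fun _ _ h => Submodule.map_mono (upTo_mono V _ h)
  one_mem := ⟨vac, le_upTo V le_rfl vac_mem, rfl⟩
  mul_mem := by
    rintro i j _ _ ⟨x, hx, rfl⟩ ⟨y, hy, rfl⟩
    exact ⟨star V V x y, star_mem_upTo V V hx hy, rfl⟩

instance : IsModuleFiltration (algFil V) (Filt.prev (algFil V))
    (modFil V M) (Filt.prev (modFil V M)) where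
  toIsFiltration := Filt.isFiltration fun _ _ h => Submodule.map_mono (upTo_mono M _ h)
  smul_mem := by
    rintro i j _ _ ⟨x, hx, rfl⟩ ⟨y, hy, rfl⟩
    exact ⟨star V M x y, star_mem_upTo V M hx hy, rfl⟩

/-- The graded ring `gr A(V) = ⨁ A(V)_n / A(V)_{n-1}`. -/
abbrev GrZhuAlgebra : Type _ := Filt.Gr (algFil V)

/-- The graded `gr A(V)`-module `gr A(M) = ⨁ A(M)_n / A(M)_{n-1}`. -/
abbrev GrZhuModule : Type _ := Filt.Gr (modFil V M)

/-- `M(n) → A(M)_n / A(M)_{n-1}`, `v ↦ v̄`. -/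
def symbol (n : ℕ) : AdmissibleModule.deg (M := M) V n →ₗ[ℂ] Filt.Piece (modFil V M) n :=
  (Filt.toPiece (modFil V M) n).comp
    ((toZhuModule V M).restrict fun _ hv => ⟨_, le_upTo M le_rfl hv, rfl⟩)

/-- The linear map `M → gr A(M)` with `v ↦ v̄ ∈ A(M)_n / A(M)_{n-1}` for `v ∈ M(n)`. -/
def symbolMap : M →ₗ[ℂ] GrZhuModule V M :=
  (DirectSum.toModule ℂ ℕ (GrZhuModule V M) fun n =>
    (DirectSum.lof ℂ ℕ (Filt.Piece (modFil V M)) n).comp (symbol V M n)).comp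
    (decomp (AdmissibleModule.isInternal (V := V) (M := M))).toLinearMap

theorem symbolMap_of_mem {n : ℕ} {v : M} (hv : v ∈ AdmissibleModule.deg V n) :
    symbolMap V M v = DirectSum.lof ℂ ℕ (Filt.Piece (modFil V M)) n (symbol V M n ⟨v, hv⟩) := by
  simp [symbolMap, decomp_of_mem _ hv]

theorem C2_le_ker : C2 V M ≤ LinearMap.ker (symbolMap V M) := by
  refine Submodule.span_le.2 ?_
  rintro _ ⟨a, v, rfl⟩
  change symbolMap V M (mode V M (-2) a v) = 0
  refine grade_induction (isInternal (V := V))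
    (p := fun a => symbolMap V M (mode V M (-2) a v) = 0)
    (by simp) (fun x y hx hy => by simp [hx, hy]) ?_ a
  intro p a ha
  refine grade_induction (AdmissibleModule.isInternal (V := V) (M := M))
    (p := fun v => symbolMap V M (mode V M (-2) a v) = 0)
    (by simp) (fun x y hx hy => by simp [hx, hy]) ?_ v
  intro k v hv
  have hm : mode V M (-2) a v ∈ AdmissibleModule.deg V (p + k + 1) :=
    mode_mem_deg ha hv (by push_cast; ring)
  rw [symbolMap_of_mem V M hm]
  have hz : symbol V M (p + k + 1) ⟨_, hm⟩ = 0 := by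
    refine (Submodule.Quotient.mk_eq_zero _).2 ?_
    change toZhuModule V M (mode V M (-2) a v) ∈ modFil V M (p + k)
    have h1 : res V M p (-2) a v ∈ O V M := res_mem_O_of_le ha le_rfl v
    have h2 : res V M p (-2) a v = ∑ j ∈ Finset.range p,
        (p.choose (j + 1) : ℂ) • mode V M (-2 + (j + 1 : ℕ)) a v + mode V M (-2) a v := by
      rw [res, LinearMap.sum_apply, LinearMap.sum_apply, Finset.sum_range_succ']
      simp
    have h3 : toZhuModule V M (res V M p (-2) a v) = 0 :=
      (Submodule.Quotient.mk_eq_zero _).2 h1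
    rw [h2, map_add] at h3
    rw [eq_neg_of_add_eq_zero_right h3]
    refine neg_mem ⟨_, Submodule.sum_mem _ fun j _ => Submodule.smul_mem _ _ ?_, rfl⟩
    exact intGrade_le_upTo M (by push_cast; omega) (AdmissibleModule.mode_mem p a ha _ k v hv)
  rw [hz, map_zero]

/-- The map `ψ : M / C₂(M) → gr A(M)`, `v + C₂(M) ↦ v̄ ∈ A(M)_n / A(M)_{n-1}` for `v ∈ M(n)`. -/
def psi : (M ⧸ C2 V M) →ₗ[ℂ] GrZhuModule V M :=
  (C2 V M).liftQ (symbolMap V M) (C2_le_ker V M)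

end VOA

end

/-!
Every word `a¹_{-n₁} ⋯ aᵏ_{-n_k} w` with some `nᵢ ≥ 2` dies in `gr A(M)`: translation covariance
puts `a_{-n} v` into `C₂(M)`. When all `nᵢ = 1` the word is seen through the leading term of the
product, `a ∗ v = a_{-1} v + (terms of degree < wt a + deg v)`, so that the symbol of `a_{-1} v` is
`ā • v̄`. Since every element of `gr A(M)` is a symbol, the symbols of `W` generate.
-/

namespace VOA

open VertexOperatorAlgebra

variable {V M : Type*} [AddCommGroup V] [Module ℂ V] [VertexOperatorAlgebra V]
  [AddCommGroup M] [Module ℂ M] [AdmissibleModule V M]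

theorem mode_mem_C2_of_le {c : ℤ} (hc : c ≤ -2) (a : V) (v : M) : mode V M c a v ∈ C2 V M := by
  induction c, hc using Int.leInductionDown generalizing a with
  | base => exact Submodule.subset_span ⟨a, v, rfl⟩
  | pred c hc ih =>
    have hderiv := ih (mode V V (-2) a vac)
    have hne : (-c : ℂ) ≠ 0 := neg_ne_zero.2 (Int.cast_ne_zero.2 (by omega))
    rwa [mode_derivative, Submodule.smul_mem_iff _ hne] at hderiv

theorem toZhuModule_mem_prev_modFil {c : ℤ} {n : ℕ} {x : M}
    (hx : x ∈ intGrade (AdmissibleModule.deg V) c) (hc : c < n) :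
    toZhuModule V M x ∈ Filt.prev (modFil V M) n := by
  cases n with
  | zero =>
    obtain ⟨m, rfl⟩ := Int.eq_negSucc_of_lt_zero hc
    rw [(Submodule.mem_bot ℂ).1 hx, map_zero]
    exact zero_mem _
  | succ n => exact ⟨x, intGrade_le_upTo M (by push_cast at hc; omega) hx, rfl⟩

theorem modFil_le_map_deg_sup_prev (n : ℕ) :
    modFil V M n ≤
      (AdmissibleModule.deg V n).map (toZhuModule V M) ⊔ Filt.prev (modFil V M) n := by
  refine Submodule.map_le_iff_le_comap.2 (iSup₂_le fun i hi x hx => ?_)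
  rcases (Finset.mem_range_succ_iff.1 hi).eq_or_lt with rfl | hlt
  · exact Submodule.mem_sup_left (Submodule.mem_map_of_mem hx)
  · exact Submodule.mem_sup_right
      (toZhuModule_mem_prev_modFil (c := i) hx (Int.ofNat_lt.2 hlt))

theorem symbol_eq_toPiece {n : ℕ} {v : M} (hv : v ∈ AdmissibleModule.deg V n) {y : modFil V M n}
    (h : toZhuModule V M v - y ∈ Filt.prev (modFil V M) n) :
    symbol V M n ⟨v, hv⟩ = Filt.toPiece (modFil V M) n y :=
  Filt.toPiece_eq (modFil V M) (x := ⟨toZhuModule V M v, v, le_upTo M le_rfl hv, rfl⟩) h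

theorem symbol_surjective (n : ℕ) : Function.Surjective (symbol V M n) := by
  rintro ⟨⟨y, hy⟩⟩
  obtain ⟨_, ⟨v, hv, rfl⟩, u, hu, rfl⟩ := Submodule.mem_sup.1 (modFil_le_map_deg_sup_prev n hy)
  exact ⟨⟨v, hv⟩, symbol_eq_toPiece hv (by simpa using hu)⟩

theorem symbolMap_surjective : Function.Surjective (symbolMap V M) := by
  intro y
  induction y using DirectSum.induction_on with
  | zero => exact ⟨0, map_zero _⟩
  | of n y =>
    obtain ⟨v, rfl⟩ := symbol_surjective n y
    exact ⟨v, symbolMap_of_mem V M v.2⟩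
  | add y z hy hz =>
    obtain ⟨u, rfl⟩ := hy
    obtain ⟨v, rfl⟩ := hz
    exact ⟨u + v, map_add _ u v⟩

variable (V) in
/-- The linear map `V → gr A(V)` with `a ↦ ā ∈ A(V)_n / A(V)_{n-1}` for `a ∈ V_n`. It is the symbol
map of the adjoint module, whose `gr A(M)` has the same underlying space as `gr A(V)`. -/
noncomputable def algSymbolMap : V →ₗ[ℂ] GrZhuAlgebra V := symbolMap V V

theorem algSymbolMap_of_mem {p : ℕ} {a : V} (ha : a ∈ wt p) :
    algSymbolMap V a = DirectSum.of (Filt.Piece (algFil V)) p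
      (Filt.toPiece (algFil V) p ⟨toZhuAlgebra V a, a, le_upTo V le_rfl ha, rfl⟩) :=
  symbolMap_of_mem V V ha

theorem toZhuModule_mode_neg_one_sub_star_mem_prev {p k : ℕ} {a : V} {v : M} (ha : a ∈ wt p)
    (hv : v ∈ AdmissibleModule.deg V k) :
    toZhuModule V M (mode V M (-1) a v) - toZhuModule V M (star V M a v)
      ∈ Filt.prev (modFil V M) (p + k) := by
  have hstar : star V M a v = ∑ j ∈ Finset.range p,
      (p.choose (j + 1) : ℂ) • mode V M j a v + mode V M (-1) a v := by
    rw [star_of_mem ha, res_apply, bsum, Finset.sum_range_succ']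
    simp
  rw [hstar, map_add, sub_add_cancel_right, map_sum]
  refine neg_mem (Submodule.sum_mem _ fun j _ => ?_)
  rw [map_smul]
  exact Submodule.smul_mem _ _ (toZhuModule_mem_prev_modFil
    (AdmissibleModule.mode_mem p a ha j k v hv) (by push_cast; omega))

theorem symbolMap_mode_neg_one (a : V) (v : M) :
    symbolMap V M (mode V M (-1) a v) = algSymbolMap V a • symbolMap V M v := by
  refine grade_induction (isInternal (V := V))
    (p := fun a => symbolMap V M (mode V M (-1) a v) = algSymbolMap V a • symbolMap V M v)
    (by simp) (fun a b ha hb => by simp [add_smul, ha, hb]) (fun p a ha => ?_) a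
  refine grade_induction (AdmissibleModule.isInternal (V := V))
    (p := fun v => symbolMap V M (mode V M (-1) a v) = algSymbolMap V a • symbolMap V M v)
    (by simp) (fun u v hu hv => by simp [hu, hv]) (fun k v hv => ?_) v
  have hmode : mode V M (-1) a v ∈ AdmissibleModule.deg V (p + k) :=
    mode_mem_deg ha hv (by push_cast; ring)
  rw [symbolMap_of_mem V M hmode, symbolMap_of_mem V M hv, DirectSum.lof_eq_of,
    DirectSum.lof_eq_of, algSymbolMap_of_mem ha, DirectSum.Gmodule.of_smul_of]
  exact congrArg _ <| symbol_eq_toPiece hmode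
    (y := ⟨toZhuModule V M (star V M a v), star V M a v,
      star_mem_upTo V M (le_upTo V le_rfl ha) (le_upTo M le_rfl hv), rfl⟩)
    (toZhuModule_mode_neg_one_sub_star_mem_prev ha hv)

/-- `gr A(V)` is given only a ring structure, so a scalar has to act as a multiple of `𝟏`. -/
theorem symbolMap_smul (c : ℂ) (v : M) :
    symbolMap V M (c • v) = algSymbolMap V (c • vac) • symbolMap V M v := by
  rw [← symbolMap_mode_neg_one, (mode V M (-1)).map_smul, LinearMap.smul_apply, vac_mode_eq,
    if_pos rfl]

theorem symbolMap_mem_span_of_isWord {W : Set M} {x : M} (hx : IsWord V M W x) :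
    symbolMap V M x ∈ Submodule.span (GrZhuAlgebra V) (symbolMap V M '' W) := by
  induction hx with
  | base w hw => exact Submodule.subset_span ⟨w, hw, rfl⟩
  | step _ _ a _ n hn x _ ih =>
    rcases hn.eq_or_lt with rfl | hn
    · rw [Nat.cast_one, symbolMap_mode_neg_one]
      exact Submodule.smul_mem _ _ ih
    · have hzero : symbolMap V M (mode V M (-n) a x) = 0 :=
        C2_le_ker V M (mode_mem_C2_of_le (by omega) a x)
      rw [hzero]
      exact zero_mem _

theorem symbolMap_mem_span_of_mem_span_isWord {W : Set M} {x : M}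
    (hx : x ∈ Submodule.span ℂ {x : M | IsWord V M W x}) :
    symbolMap V M x ∈ Submodule.span (GrZhuAlgebra V) (symbolMap V M '' W) := by
  induction hx using Submodule.span_induction with
  | mem x hx => exact symbolMap_mem_span_of_isWord hx
  | zero => exact map_zero (symbolMap V M) ▸ zero_mem _
  | add x y _ _ hx hy => exact map_add (symbolMap V M) x y ▸ add_mem hx hy
  | smul c x _ hx => exact symbolMap_smul (V := V) c x ▸ Submodule.smul_mem _ _ hx

theorem StronglyGeneratedBy.span_psi_image_eq_top {W : Set M} (hW : StronglyGeneratedBy V M W) :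
    Submodule.span (GrZhuAlgebra V) (psi V M '' ((C2 V M).mkQ '' W)) = ⊤ := by
  have himage : psi V M '' ((C2 V M).mkQ '' W) = symbolMap V M '' W := Set.image_image _ _ _
  rw [himage, eq_top_iff]
  intro y _
  obtain ⟨x, rfl⟩ := symbolMap_surjective y
  exact symbolMap_mem_span_of_mem_span_isWord (hW.ge Submodule.mem_top)

end VOA

theorem proposition4p7_general {V M : Type*} [AddCommGroup V] [Module ℂ V]
    [VertexOperatorAlgebra V] [AddCommGroup M] [Module ℂ M] [AdmissibleModule V M] :
    (∀ W : Set M, VOA.StronglyGeneratedBy V M W →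
      Submodule.span (VOA.GrZhuAlgebra V) (VOA.psi V M '' ((VOA.C2 V M).mkQ '' W)) = ⊤) ∧
    (VOA.StronglyFinitelyGenerated V M →
      Module.Finite (VOA.GrZhuAlgebra V) (VOA.GrZhuModule V M)) := by
  refine ⟨fun W hW => hW.span_psi_image_eq_top, fun ⟨W, hfin, hW⟩ => ⟨?_⟩⟩
  exact Submodule.fg_def.2 ⟨_, (hfin.image _).image _, hW.span_psi_image_eq_top⟩

theorem proposition4p7 {V M : Type*} [AddCommGroup V] [Module ℂ V] [VertexOperatorAlgebra V]
    [AddCommGroup M] [Module ℂ M] [AdmissibleModule V M]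
    (hV : VertexOperatorAlgebra.IsCFTType V) :
    (∀ W : Set M, VOA.StronglyGeneratedBy V M W →
      Submodule.span (VOA.GrZhuAlgebra V) (VOA.psi V M '' ((VOA.C2 V M).mkQ '' W)) = ⊤) ∧
    (VOA.StronglyFinitelyGenerated V M →
      Module.Finite (VOA.GrZhuAlgebra V) (VOA.GrZhuModule V M)) :=
  proposition4p7_general
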